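/- Let $R>r>0$ be real numbers, let $c_0=\log\left(\frac{R^2+r^2}{2rR}\right)$, let $t\ge 2$ be an integer, and put $$\gamma_t=\max_{2\le\tau\le t}\left(\frac12\left(\frac{c_0}{3\tau}\right)^{\tau}\right)^{-\frac{1}{\tau-1}},$$ the maximum being over the integers $\tau$ with $2\le\tau\le t$. Let $\gamma>\gamma_t$ be a real number. Let $f_1,\dots,f_t$ be complex-valued functions that are analytic on the open disc $\{|z|<R\}$, continuous on the closed disc $\{|z|\le R\}$, and algebraically independent over $\mathbf{Q}$. For an integer $D\ge 1$ and a real number $N\ge 0$, let $\Sigma_{D,N}(f_1,\dots,f_t,r)$ be the set of complex numbers $w$ with $|w|\le r$ such that $$f_i(w)\in\overline{\mathbf{Q}}\ \text{ and }\ h(f_i(w))\le N\quad\text{for all } i\in\{1,\dots,t\},\qquad\text{and}\qquad [\mathbf{Q}(f_1(w),\dots,f_t(w)):\mathbf{Q}]\le D,$$ where $h$ is the absolute logarithmic height: for $\alpha$ in a number field $K$, $h(\alpha)=\frac{1}{[K:\mathbf{Q}]}\sum_{v} d_v\log\max\{1,|\alpha|_v\}$, the sum being over the places $v$ of $K$,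 with $|\cdot|_v$ extending the standard absolute value of $\mathbf{Q}$ below $v$ and $d_v$ the local degree. (i) For every integer $D\ge1$ there are arbitrarily large real numbers $N\ge 0$ for which $\Sigma_{D,N}(f_1,\dots,f_t,r)$ is finite and $$\#\Sigma_{D,N}(f_1,\dots,f_t,r)<\gamma\,D^{\frac{t+1}{t-1}}\,N^{\frac{t}{t-1}}.$$ (ii) For every real number $N>0$ there are arbitrarily large integers $D\ge2$ for which $\Sigma_{D,N}(f_1,\dots,f_t,r)$ is finite and $$\#\Sigma_{D,N}(f_1,\dots,f_t,r)<\gamma\,D^{\frac{t+1}{t-1}}\,N^{\frac{t}{t-1}}.$$ -/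

import Mathlib

open Set Metric

noncomputable section

namespace AlgValues

/-- The constant `c₀ = log ((R² + r²) / (2 r R))`. -/
def c₀ (r R : ℝ) : ℝ := Real.log ((R ^ 2 + r ^ 2) / (2 * r * R))

/-- The constant `γ_t`: the maximum over the integers `2 ≤ τ ≤ t` of
`((1/2) (c₀ / (3 τ)) ^ τ) ^ (-1 / (τ - 1))`. -/
def gammaConst (r R : ℝ) (t : ℕ) (ht : 2 ≤ t) : ℝ :=
  (Finset.Icc 2 t).sup' (Finset.nonempty_Icc.mpr ht) fun τ : ℕ =>
    ((1 / 2 : ℝ) * (c₀ r R / (3 * (τ : ℝ))) ^ τ) ^ (-1 / ((τ : ℝ) - 1))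

/-- The set `Σ_{D,N}(f₁, …, f_t, r)` of the complex numbers `w` with `|w| ≤ r` such that every
`f i w` is algebraic of absolute logarithmic height at most `N`, and such that the number field
generated by all the `f i w` has degree at most `D`. -/
def sigmaSet {t : ℕ} (f : Fin t → ℂ → ℂ) (r : ℝ) (D : ℕ) (N : ℝ) : Set ℂ :=
  {w | w ∈ closedBall (0 : ℂ) r ∧
    (∀ i, IsAlgebraic ℚ (f i w) ∧ NumberField.absLogHeight₁ (f i w) ≤ N) ∧
    Module.finrank ℚ (IntermediateField.adjoin ℚ (range fun i => f i w)) ≤ D}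

end AlgValues

end

/-! The argument is a transcendence proof with an auxiliary polynomial. Suppose the bound `X =
countBound γ t D N` fails for all large `N` (or all large `D`). Take about `X` points of the first
set. A Siegel lemma (`exists_boxEval_eq_zero`) gives a nonzero integral `P`, of degree less than `L`
in each of `t` variables, such that `F = P(f₁, …, f_t)` vanishes at those points. This needs `L ^ t`
to be about `2DX`, and the logarithm of the coefficients is then about `tLN`.

At a point `w` of the next set, Blaschke factors (`norm_le_of_vanishing`) make `|F w|` smaller by
`exp (-c₀ X)`, while Liouville's inequality (`one_le_norm_boxEval_mul`) bounds a nonzero `|F w|`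
from below by about `exp (-2tDLN)`. So `F w = 0` once `c₀ X ≥ 3tDNL`, up to lower-order terms. With
`L ^ t = 2DX` this condition reads `X ^ (t-1) ≥ 2D (3tDN/c₀) ^ t`, which explains the constant and
both exponents.

As `X` grows at least linearly in `N` and in `D`, the step repeats forever with the same `P`
(`false_of_sigmaSet_large`). Then `F` has infinitely many zeros in a compact disc, so `F = 0`,
against algebraic independence. -/

namespace AlgValues

open NumberField Height

/-! ### Heights in number fields: comparison of relative and absolute heights. -/

section Heights

variable {K : Type*} [Field K] [NumberField K]

lemma prod_embeddings_eq_prod_infinitePlace (g : InfinitePlace K → ℝ) :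
    ∏ φ : K →+* ℂ, g (InfinitePlace.mk φ) = ∏ v : InfinitePlace K, g v ^ v.mult := by
  classical
  rw [← Finset.prod_fiberwise Finset.univ (fun φ : K →+* ℂ => InfinitePlace.mk φ)]
  refine Finset.prod_congr rfl fun v _ => ?_
  rw [Finset.prod_congr rfl (g := fun _ => g v)
    (fun φ hφ => by rw [(Finset.mem_filter.mp hφ).2]), Finset.prod_const,
    InfinitePlace.card_filter_mk_eq]

/-- The height of `x` in terms of the complex embeddings and the finite places. -/
lemma mulHeight₁_eq_prod_embeddings (x : K) :
    mulHeight₁ x = (∏ φ : K →+* ℂ, max ‖φ x‖ 1) * ∏ᶠ v : FinitePlace K, max (v x) 1 := by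
  rw [NumberField.mulHeight₁_eq,
    ← prod_embeddings_eq_prod_infinitePlace (fun v : InfinitePlace K => max (v x) 1)]
  rfl

/-- The product formula in terms of the complex embeddings and the finite places. -/
lemma prod_embeddings_mul_finprod_eq_one {x : K} (hx : x ≠ 0) :
    (∏ φ : K →+* ℂ, ‖φ x‖) * ∏ᶠ v : FinitePlace K, v x = 1 := by
  rw [← NumberField.prod_abs_eq_one hx,
    ← prod_embeddings_eq_prod_infinitePlace (fun v : InfinitePlace K => v x)]
  rfl

/-- The height of a quotient of algebraic integers. -/
lemma absNorm_mul_mulHeight₁_div {a b : 𝓞 K} (hb : b ≠ 0) :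
    ((Ideal.span {a, b}).absNorm : ℝ) * mulHeight₁ ((a : K) / (b : K)) =
      ∏ φ : K →+* ℂ, max ‖φ (a : K)‖ ‖φ (b : K)‖ := by
  have hne : (![a, b] : Fin 2 → 𝓞 K) ≠ 0 := fun h => hb (by simpa using congrFun h 1)
  have hne' : (![(a : K), (b : K)] : Fin 2 → K) ≠ 0 := fun h => hb (by
    simpa using congrFun h 1)
  have hsup : ∀ g : K → ℝ, ⨆ i, g ((![(a : K), (b : K)] : Fin 2 → K) i) = max (g a) (g b) := by
    intro g
    refine le_antisymm (ciSup_le fun i => by fin_cases i <;> simp) (max_le ?_ ?_)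
    · exact Finite.le_ciSup (fun i => g ((![(a : K), (b : K)] : Fin 2 → K) i)) 0
    · exact Finite.le_ciSup (fun i => g ((![(a : K), (b : K)] : Fin 2 → K) i)) 1
  have hfin := absNorm_mul_finprod_finitePlace_eq_one (K := K) hne
  have hcoe : ∀ i, (((![a, b] : Fin 2 → 𝓞 K) i : 𝓞 K) : K) =
      (![(a : K), (b : K)] : Fin 2 → K) i := by
    intro i; fin_cases i <;> rfl
  simp only [hcoe] at hfin
  rw [Matrix.range_cons, Matrix.range_cons, Matrix.range_empty, union_empty,
    Set.singleton_union] at hfin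
  rw [mulHeight₁_div_eq_mulHeight, NumberField.mulHeight_eq hne', mul_left_comm, hfin, mul_one,
    ← prod_embeddings_eq_prod_infinitePlace
      (fun v : InfinitePlace K => ⨆ i, v ((![(a : K), (b : K)] : Fin 2 → K) i))]
  refine Finset.prod_congr rfl fun φ _ => ?_
  rw [hsup (fun y => InfinitePlace.mk φ y)]
  rfl

variable {F : Type*} [Field F] [NumberField F] [Algebra F K]

/-- Once `ℂ` is an `F`-algebra through `ψ`, the extensions of `ψ` to `K` are exactly the `F`-algebra
maps `K → ℂ`. -/
lemma card_filter_comp_algebraMap_eq (ψ : F →+* ℂ) [DecidableEq (F →+* ℂ)] :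
    (Finset.univ.filter fun φ : K →+* ℂ => φ.comp (algebraMap F K) = ψ).card =
      Module.finrank F K := by
  let _ := ψ.toAlgebra
  have : FiniteDimensional F K := .right ℚ F K
  rw [← AlgHom.card F K ℂ, ← Fintype.card_subtype]
  refine Fintype.card_congr
    { toFun := fun φ => { φ.1 with commutes' := fun x => RingHom.congr_fun φ.2 x }
      invFun := fun σ => ⟨σ.toRingHom, RingHom.ext fun x => σ.commutes x⟩
      left_inv := fun φ => rfl
      right_inv := fun σ => rfl }

lemma prod_embeddings_comp_algebraMap (g : (F →+* ℂ) → ℝ) :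
    ∏ φ : K →+* ℂ, g (φ.comp (algebraMap F K)) = (∏ ψ : F →+* ℂ, g ψ) ^ Module.finrank F K := by
  classical
  rw [← Finset.prod_fiberwise Finset.univ (fun φ : K →+* ℂ => φ.comp (algebraMap F K)),
    ← Finset.prod_pow]
  refine Finset.prod_congr rfl fun ψ _ => ?_
  rw [Finset.prod_congr rfl (g := fun _ => g ψ)
    (fun φ hφ => by rw [(Finset.mem_filter.mp hφ).2]), Finset.prod_const,
    card_filter_comp_algebraMap_eq (K := K) ψ]

/-- The behaviour of the relative height under extension of the number field. -/
theorem mulHeight₁_algebraMap (x : F) :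
    mulHeight₁ (algebraMap F K x) = mulHeight₁ x ^ Module.finrank F K := by
  have : FiniteDimensional F K := .right ℚ F K
  obtain ⟨a, b, hb, rfl⟩ := IsFractionRing.div_surjective (𝓞 F) x
  have hb0 : b ≠ 0 := nonZeroDivisors.ne_zero hb
  have hinj : Function.Injective (algebraMap (𝓞 F) (𝓞 K)) :=
    FaithfulSMul.algebraMap_injective (𝓞 F) (𝓞 K)
  have hb1 : algebraMap (𝓞 F) (𝓞 K) b ≠ 0 := fun h => hb0 (hinj (by rw [h, map_zero]))
  have h1 := absNorm_mul_mulHeight₁_div (K := F) (a := a) hb0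
  have h2 := absNorm_mul_mulHeight₁_div (K := K) (a := algebraMap (𝓞 F) (𝓞 K) a) hb1
  have hspan : Ideal.span {algebraMap (𝓞 F) (𝓞 K) a, algebraMap (𝓞 F) (𝓞 K) b} =
      (Ideal.span {a, b}).map (algebraMap (𝓞 F) (𝓞 K)) := by
    rw [Ideal.map_span, Set.image_pair]
  have hcoe : ∀ c : 𝓞 F, ((algebraMap (𝓞 F) (𝓞 K) c : 𝓞 K) : K) = algebraMap F K (c : F) :=
    fun c => rfl
  -- In `absNorm_mul_mulHeight₁_div` the ideal norm and the product over embeddings are both raised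
  -- to the power `[K : F]` on passing to `K`; hence so is the height.
  rw [hspan, Ideal.absNorm_algebraMap, ← IsFractionRing.finrank_eq (𝓞 F) F (𝓞 K) K] at h2
  simp only [hcoe] at h2
  have h3 := prod_embeddings_comp_algebraMap (K := K)
    (fun ψ : F →+* ℂ => max ‖ψ (a : F)‖ ‖ψ (b : F)‖)
  simp only [RingHom.comp_apply] at h3
  rw [h3, ← h1, mul_pow, Nat.cast_pow] at h2
  have hpos : ((Ideal.span {a, b}).absNorm : ℝ) ^ Module.finrank F K ≠ 0 := by
    refine pow_ne_zero _ (Nat.cast_ne_zero.mpr ?_)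
    rw [Ne, Ideal.absNorm_eq_zero_iff, Ideal.span_eq_bot]
    exact fun h => hb0 (h b (by simp))
  rw [map_div₀]
  exact mul_left_cancel₀ hpos h2

/-- The relative height over a subfield of `ℂ` in terms of the absolute height. -/
theorem mulHeight₁_eq_exp_absLogHeight₁ (K : IntermediateField ℚ ℂ) [NumberField K] (x : K) :
    mulHeight₁ x = Real.exp (Module.finrank ℚ K * absLogHeight₁ (x : ℂ)) := by
  have hx : IsIntegral ℚ (x : ℂ) := by
    have := (Algebra.IsIntegral.isIntegral (R := ℚ) x).map K.val
    simpa using this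
  have hle : IntermediateField.adjoin ℚ {(x : ℂ)} ≤ K := by
    simp
  have hfd : FiniteDimensional ℚ (IntermediateField.adjoin ℚ {(x : ℂ)}) :=
    IntermediateField.adjoin.finiteDimensional hx
  have hnf : NumberField (IntermediateField.adjoin ℚ {(x : ℂ)}) := {}
  let _ := (IntermediateField.inclusion hle).toRingHom.toAlgebra
  have htower : IsScalarTower ℚ (IntermediateField.adjoin ℚ {(x : ℂ)}) K :=
    IsScalarTower.of_algebraMap_eq' 
      (RingHom.ext fun q => ((IntermediateField.inclusion hle).commutes q).symm)
  have hgen : algebraMap (IntermediateField.adjoin ℚ {(x : ℂ)}) K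
      (IntermediateField.AdjoinSimple.gen ℚ (x : ℂ)) = x := rfl
  have hbase := mulHeight₁_algebraMap (K := K) (IntermediateField.AdjoinSimple.gen ℚ (x : ℂ))
  rw [hgen] at hbase
  have hd : (0 : ℝ) < Module.finrank ℚ (IntermediateField.adjoin ℚ {(x : ℂ)}) := by
    exact_mod_cast Module.finrank_pos
  rw [hbase, absLogHeight₁, absMulHeight₁, dif_pos hx, Real.log_rpow (mulHeight₁_pos _),
    ← Module.finrank_mul_finrank ℚ (IntermediateField.adjoin ℚ {(x : ℂ)}) K]
  rw [← Real.exp_log (mulHeight₁_pos (IntermediateField.AdjoinSimple.gen ℚ (x : ℂ))),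
    ← Real.exp_nat_mul, Real.log_exp]
  congr 1
  push_cast
  field_simp

end Heights

end AlgValues

namespace AlgValues

open ComplexConjugate

/-! ### Schwarz lemma with many zeros. -/

section Schwarz

lemma c₀_pos {r R : ℝ} (hr : 0 < r) (hrR : r < R) : 0 < c₀ r R := by
  have hR : 0 < R := hr.trans hrR
  refine Real.log_pos ?_
  rw [one_lt_div (by positivity)]
  nlinarith [sq_pos_of_pos (sub_pos.mpr hrR)]

lemma exp_neg_c₀ {r R : ℝ} (hr : 0 < r) (hrR : r < R) :
    Real.exp (-c₀ r R) = 2 * r * R / (R ^ 2 + r ^ 2) := by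
  have hR : 0 < R := hr.trans hrR
  rw [c₀, Real.exp_neg, Real.exp_log (by positivity), inv_div]

/-- Serves twice: for `‖z‖ = R` it says that the Blaschke factor has modulus one, and inside the
disc it measures how far below one the factor is. -/
lemma sq_norm_blaschke_denom_sub (R : ℝ) (a z : ℂ) :
    ‖(R : ℂ) ^ 2 - conj a * z‖ ^ 2 - ‖(R : ℂ) * (z - a)‖ ^ 2 =
      (R ^ 2 - ‖a‖ ^ 2) * (R ^ 2 - ‖z‖ ^ 2) := by
  simp only [Complex.sq_norm, Complex.normSq_apply]
  simp only [Complex.sub_re, Complex.sub_im,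
    Complex.mul_re, Complex.mul_im, Complex.conj_re, Complex.conj_im, Complex.ofReal_re,
    Complex.ofReal_im, pow_two]
  ring

/-- The bound for a Blaschke factor of the disc of radius `R` on the disc of radius `r`. -/
lemma norm_blaschke_le {r R : ℝ} (hr : 0 < r) (hrR : r < R) {a z : ℂ} (ha : ‖a‖ ≤ r)
    (hz : ‖z‖ ≤ r) :
    ‖(R : ℂ) * (z - a)‖ ≤ Real.exp (-c₀ r R) * ‖(R : ℂ) ^ 2 - conj a * z‖ := by
  have hR : 0 < R := hr.trans hrR
  have h := sq_norm_blaschke_denom_sub R a z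
  rw [exp_neg_c₀ hr hrR]
  set P := ‖(R : ℂ) ^ 2 - conj a * z‖
  set Q := ‖(R : ℂ) * (z - a)‖
  have hP : P ≤ R ^ 2 + r ^ 2 := by
    refine (norm_sub_le _ _).trans ?_
    rw [norm_mul, RCLike.norm_conj, norm_pow, Complex.norm_real, Real.norm_eq_abs, sq_abs]
    nlinarith [norm_nonneg a, norm_nonneg z]
  have hP0 : 0 ≤ P := norm_nonneg _
  have ha2 : ‖a‖ ^ 2 ≤ r ^ 2 := pow_le_pow_left₀ (norm_nonneg _) ha 2
  have hz2 : ‖z‖ ^ 2 ≤ r ^ 2 := pow_le_pow_left₀ (norm_nonneg _) hz 2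
  have hr2 : r ^ 2 < R ^ 2 := pow_lt_pow_left₀ hrR hr.le two_ne_zero
  have h1 : (R ^ 2 - r ^ 2) * (R ^ 2 - r ^ 2) ≤ P ^ 2 - Q ^ 2 := by
    rw [h]
    exact mul_le_mul (by linarith) (by linarith) (by linarith) (by linarith)
  have h2 : P ^ 2 ≤ (R ^ 2 + r ^ 2) ^ 2 := pow_le_pow_left₀ hP0 hP 2
  -- The squared quotient is at most `1 - (R² - r²)² / (R² + r²)²`, and the numerator left over is
  -- `(R² + r²)² - (R² - r²)² = (2rR)²`.
  refine le_of_sq_le_sq ?_ (by positivity)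
  rw [mul_pow, div_pow, div_mul_eq_mul_div, le_div_iff₀ (by positivity)]
  have h3 : 0 ≤ (R ^ 2 - r ^ 2) ^ 2 := sq_nonneg _
  nlinarith [mul_le_mul_of_nonneg_left h1 (sq_nonneg (R ^ 2 + r ^ 2)),
    mul_le_mul_of_nonneg_left h2 h3]

/-- Schwarz lemma for a function with zeros at the points of a finite set. -/
theorem norm_le_of_vanishing {r R : ℝ} (hr : 0 < r) (hrR : r < R) (S : Finset ℂ) :
    ∀ {F : ℂ → ℂ} {M : ℝ}, DifferentiableOn ℂ F (ball 0 R) →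
      ContinuousOn F (closedBall 0 R) → (∀ z ∈ closedBall (0 : ℂ) R, ‖F z‖ ≤ M) →
      (∀ a ∈ S, ‖a‖ ≤ r) → (∀ a ∈ S, F a = 0) →
      ∀ {w : ℂ}, ‖w‖ ≤ r → ‖F w‖ ≤ M * Real.exp (-(c₀ r R * S.card)) := by
  classical
  have hR : 0 < R := hr.trans hrR
  induction S using Finset.induction_on with
  | empty =>
    intro F M _ _ hM _ _ w hw
    simpa using hM w (by simpa using hw.trans hrR.le)
  | insert a S haS ih =>
    intro F M hd hc hM hS hF w hw
    have har : ‖a‖ ≤ r := hS a (by simp)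
    have haR : a ∈ ball (0 : ℂ) R := by simpa using har.trans_lt hrR
    have hFa : F a = 0 := hF a (by simp)
    have hnhd : ball (0 : ℂ) R ∈ nhds a := isOpen_ball.mem_nhds haR
    have hnhd' : closedBall (0 : ℂ) R ∈ nhds a :=
      Filter.mem_of_superset hnhd ball_subset_closedBall
    have hslope : ∀ z, (z - a) * dslope F a z = F z := fun z => by
      have := sub_smul_dslope F a z
      rwa [hFa, sub_zero, smul_eq_mul] at this
    -- `F` divided by its Blaschke factor at `a`. The quotient has the same modulus as `F` on the
    -- circle, so by the maximum principle the bound `M` survives and the induction can go on with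
    -- `G`.
    set G : ℂ → ℂ := fun z => dslope F a z * (((R : ℂ) ^ 2 - conj a * z) / R) with hG
    have hRC : (R : ℂ) ≠ 0 := by exact_mod_cast hR.ne'
    have hGF : ∀ z, (R : ℂ) * (z - a) * G z = F z * ((R : ℂ) ^ 2 - conj a * z) := fun z => by
      rw [← hslope z, hG]; field_simp
    have hdG : DifferentiableOn ℂ G (ball 0 R) :=
      ((Complex.differentiableOn_dslope hnhd).mpr hd).mul (by fun_prop)
    have hcG : ContinuousOn G (closedBall 0 R) :=
      ((continuousOn_dslope hnhd').mpr ⟨hc, (hd a haR).differentiableAt hnhd⟩).mul (by fun_prop)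
    have hden : ∀ z ∈ closedBall (0 : ℂ) R, (R : ℂ) ^ 2 - conj a * z ≠ 0 := by
      intro z hz h0
      have h1 : ‖(R : ℂ) ^ 2‖ = ‖conj a * z‖ := by rw [sub_eq_zero.mp h0]
      rw [norm_mul, RCLike.norm_conj, norm_pow, Complex.norm_real, Real.norm_eq_abs, sq_abs] at h1
      have hz' : ‖z‖ ≤ R := by simpa using hz
      nlinarith [norm_nonneg z, norm_nonneg a]
    have hbd : ∀ z ∈ closedBall (0 : ℂ) R, ‖G z‖ ≤ M := by
      intro z hz
      refine Complex.norm_le_of_forall_mem_frontier_norm_le (U := ball (0 : ℂ) R) isBounded_ball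
        ⟨hdG, ?_⟩ ?_ ?_
      · rwa [closure_ball _ hR.ne']
      · intro y hy
        rw [frontier_ball _ hR.ne'] at hy
        have hyR : ‖y‖ = R := by simpa using hy
        have hyc : y ∈ closedBall (0 : ℂ) R := sphere_subset_closedBall hy
        have h1 := sq_norm_blaschke_denom_sub R a y
        rw [hyR, sub_self, mul_zero, sub_eq_zero] at h1
        have h2 : ‖(R : ℂ) ^ 2 - conj a * y‖ = ‖(R : ℂ) * (y - a)‖ :=
          (pow_left_inj₀ (norm_nonneg _) (norm_nonneg _) two_ne_zero).mp h1
        have h3 := congrArg norm (hGF y)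
        rw [norm_mul, norm_mul (F y), h2, mul_comm] at h3
        have h4 : ‖(R : ℂ) * (y - a)‖ ≠ 0 := by
          rw [← h2]; exact norm_ne_zero_iff.mpr (hden y hyc)
        rw [mul_right_cancel₀ h4 h3]
        exact hM y hyc
      · rwa [closure_ball _ hR.ne']
    have hGS : ∀ b ∈ S, G b = 0 := by
      intro b hb
      have hba : b - a ≠ 0 := sub_ne_zero.mpr fun h => haS (h ▸ hb)
      have h1 := hGF b
      rw [hF b (by simp [hb]), zero_mul] at h1
      exact (mul_eq_zero.mp h1).resolve_left (mul_ne_zero hRC hba)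
    have hGw := ih hdG hcG hbd (fun b hb => hS b (by simp [hb])) hGS hw
    have hwR : w ∈ closedBall (0 : ℂ) R := by simpa using hw.trans hrR.le
    have hwd : 0 < ‖(R : ℂ) ^ 2 - conj a * w‖ := norm_pos_iff.mpr (hden w hwR)
    have h3 := congrArg norm (hGF w)
    rw [norm_mul, norm_mul (F w)] at h3
    rw [Finset.card_insert_of_notMem haS]
    refine le_of_mul_le_mul_right ?_ hwd
    rw [← h3]
    calc ‖(R : ℂ) * (w - a)‖ * ‖G w‖
        ≤ (Real.exp (-c₀ r R) * ‖(R : ℂ) ^ 2 - conj a * w‖) *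
          (M * Real.exp (-(c₀ r R * S.card))) :=
          mul_le_mul (norm_blaschke_le hr hrR har hw) hGw (norm_nonneg _) (by positivity)
      _ = M * Real.exp (-(c₀ r R * (S.card + 1 : ℕ))) * ‖(R : ℂ) ^ 2 - conj a * w‖ := by
          have : -(c₀ r R * ((S.card + 1 : ℕ) : ℝ)) = -c₀ r R + -(c₀ r R * S.card) := by
            push_cast; ring
          rw [this, Real.exp_add]; ring

/-- A function holomorphic on a disc with infinitely many zeros in a smaller closed disc
vanishes identically. -/
theorem eqOn_zero_of_infinite_zeros {r R : ℝ} (hrR : r < R) {F : ℂ → ℂ}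
    (hF : AnalyticOnNhd ℂ F (ball 0 R))
    (hinf : {z ∈ closedBall (0 : ℂ) r | F z = 0}.Infinite) : EqOn F 0 (ball 0 R) := by
  obtain ⟨z, hz, hacc⟩ := hinf.exists_accPt_of_subset_isCompact
    (isCompact_closedBall (0 : ℂ) r) (fun w hw => hw.1)
  refine hF.eqOn_zero_of_preconnected_of_frequently_eq_zero
    (convex_ball (0 : ℂ) R).isPreconnected (closedBall_subset_ball hrR hz) ?_
  rw [accPt_iff_frequently_nhdsNE] at hacc
  exact hacc.mono fun w hw => hw.2

end Schwarz

end AlgValues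

namespace AlgValues

open NumberField Height ComplexConjugate

/-! ### Pigeonhole principle for real linear forms. -/

section Pigeonhole

/-- A system of real linear forms has a small nonzero integral vector on which all forms are
small, when the number of unknowns is at least twice the number of forms. -/
theorem exists_int_vec_linearForms_le {ι J : Type*} [Fintype ι] [Fintype J] [Nonempty ι]
    (l : J → ι → ℝ) {A : ℝ} (hA : 0 < A) (hl : ∀ j, ∑ i, |l j i| ≤ A)
    (hcard : 2 * Fintype.card J ≤ Fintype.card ι) {H : ℕ} (hH : 0 < H) :
    ∃ q : ι → ℤ, q ≠ 0 ∧ (∀ i, |q i| ≤ H) ∧ ∀ j, |∑ i, l j i * q i| ≤ 2 * A / H := by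
  classical
  have hH' : (0 : ℝ) < H := by exact_mod_cast hH
  have hbound : ∀ (u : ι → Fin (H + 1)) (j : J), |∑ i, l j i * ((u i : ℕ) : ℝ)| ≤ A * H := by
    intro u j
    calc |∑ i, l j i * ((u i : ℕ) : ℝ)| ≤ ∑ i, |l j i * ((u i : ℕ) : ℝ)| :=
          Finset.abs_sum_le_sum_abs _ _
      _ ≤ ∑ i, |l j i| * H := by
          refine Finset.sum_le_sum fun i _ => ?_
          rw [abs_mul, Nat.abs_cast]
          have : ((u i : ℕ) : ℝ) ≤ H := by exact_mod_cast Nat.lt_succ_iff.mp (u i).2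
          exact mul_le_mul_of_nonneg_left this (abs_nonneg _)
      _ = (∑ i, |l j i|) * H := by rw [Finset.sum_mul]
      _ ≤ A * H := mul_le_mul_of_nonneg_right (hl j) hH'.le
  -- The values of each form fill an interval of length at most `2AH`, rescaled here to `[0, H²]`.
  -- Equal integer parts then mean a difference of at most `2A/H`, and `H² + 1 < (H + 1)²` leaves
  -- fewer boxes than vectors.
  set g : (ι → Fin (H + 1)) → J → ℝ := fun u j =>
    (∑ i, l j i * ((u i : ℕ) : ℝ) + A * H) * (H / (2 * A)) with hg
  have hg0 : ∀ u j, 0 ≤ g u j := fun u j =>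
    mul_nonneg (by linarith [(abs_le.mp (hbound u j)).1]) (by positivity)
  have hg1 : ∀ u j, g u j ≤ (H ^ 2 : ℕ) := fun u j => by
    have h1 : g u j ≤ (A * H + A * H) * (H / (2 * A)) :=
      mul_le_mul_of_nonneg_right (by linarith [(abs_le.mp (hbound u j)).2]) (by positivity)
    refine h1.trans (le_of_eq ?_)
    push_cast
    field_simp
    ring
  let T : (ι → Fin (H + 1)) → (J → Fin (H ^ 2 + 1)) := fun u j =>
    ⟨⌊g u j⌋₊, Nat.lt_succ_of_le (Nat.floor_le_of_le (hg1 u j))⟩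
  have hlt : Fintype.card (J → Fin (H ^ 2 + 1)) < Fintype.card (ι → Fin (H + 1)) := by
    rw [Fintype.card_fun, Fintype.card_fun, Fintype.card_fin, Fintype.card_fin]
    rcases Nat.eq_zero_or_pos (Fintype.card J) with h0 | h0
    · rw [h0, pow_zero]
      exact Nat.one_lt_pow Fintype.card_ne_zero (by omega)
    · calc (H ^ 2 + 1) ^ Fintype.card J < ((H + 1) ^ 2) ^ Fintype.card J :=
            Nat.pow_lt_pow_left (by nlinarith) h0.ne'
        _ = (H + 1) ^ (2 * Fintype.card J) := by rw [pow_mul]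
        _ ≤ (H + 1) ^ Fintype.card ι := Nat.pow_le_pow_right (by omega) hcard
  obtain ⟨u, v, huv, hT⟩ := Fintype.exists_ne_map_eq_of_card_lt T hlt
  refine ⟨fun i => ((u i : ℕ) : ℤ) - ((v i : ℕ) : ℤ), ?_, ?_, ?_⟩
  · intro h
    refine huv (funext fun i => Fin.ext ?_)
    have := congrFun h i
    simp only [Pi.zero_apply] at this
    omega
  · intro i
    have h1 := (u i).2
    have h2 := (v i).2
    simp only [abs_le]
    constructor <;> omega
  · intro j
    have hfl : ⌊g u j⌋₊ = ⌊g v j⌋₊ := congrArg Fin.val (congrFun hT j)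
    have h1 : |g u j - g v j| ≤ 1 := by
      have a1 := Nat.floor_le (hg0 u j)
      have a2 := Nat.lt_floor_add_one (g u j)
      have b1 := Nat.floor_le (hg0 v j)
      have b2 := Nat.lt_floor_add_one (g v j)
      rw [hfl] at a1 a2
      rw [abs_le]
      constructor <;> linarith
    have h2 : g u j - g v j =
        (∑ i, l j i * ((((u i : ℕ) : ℤ) - ((v i : ℕ) : ℤ) : ℤ) : ℝ)) * (H / (2 * A)) := by
      have : ∑ i, l j i * ((((u i : ℕ) : ℤ) - ((v i : ℕ) : ℤ) : ℤ) : ℝ) =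
          ∑ i, l j i * ((u i : ℕ) : ℝ) - ∑ i, l j i * ((v i : ℕ) : ℝ) := by
        rw [← Finset.sum_sub_distrib]
        refine Finset.sum_congr rfl fun i _ => ?_
        push_cast
        ring
      rw [this, hg]
      ring
    rw [h2, abs_mul, abs_of_pos (show (0 : ℝ) < H / (2 * A) by positivity),
      ← le_div_iff₀ (by positivity)] at h1
    refine h1.trans (le_of_eq ?_)
    rw [one_div_div]

end Pigeonhole

/-! ### Polynomial values and the product formula. -/

section BoxEval

/-- The value at `x` of the polynomial with integral coefficients `q`, whose degree in each
variable is less than `L`. -/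
noncomputable def boxEval {A : Type*} [CommRing A] {t L : ℕ} (q : (Fin t → Fin L) → ℤ)
    (x : Fin t → A) : A :=
  ∑ l, (q l : A) * ∏ i, x i ^ (l i : ℕ)

variable {t L : ℕ}

lemma map_boxEval {A B : Type*} [CommRing A] [CommRing B] (φ : A →+* B)
    (q : (Fin t → Fin L) → ℤ) (x : Fin t → A) :
    φ (boxEval q x) = boxEval q fun i => φ (x i) := by
  simp [boxEval]

lemma prod_pow_le_prod_max_pow (l : Fin t → Fin L) {y : Fin t → ℝ} (hy : ∀ i, 0 ≤ y i) :
    ∏ i, y i ^ (l i : ℕ) ≤ ∏ i, max (y i) 1 ^ L := by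
  refine Finset.prod_le_prod (fun i _ => pow_nonneg (hy i) _) fun i _ => ?_
  exact (pow_le_pow_left₀ (hy i) (le_max_left _ _) _).trans
    (pow_le_pow_right₀ (le_max_right _ _) (l i).2.le)

lemma norm_boxEval_le {q : (Fin t → Fin L) → ℤ} {H : ℝ} (hq : ∀ l, |(q l : ℝ)| ≤ H)
    (x : Fin t → ℂ) :
    ‖boxEval q x‖ ≤ H * (L : ℝ) ^ t * ∏ i, max ‖x i‖ 1 ^ L := by
  refine (norm_sum_le _ _).trans ((Finset.sum_le_sum (g := fun _ => H * ∏ i, max ‖x i‖ 1 ^ L)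
    fun l _ => ?_).trans (le_of_eq ?_))
  · rw [norm_mul, norm_prod, Complex.norm_intCast]
    simp only [norm_pow]
    exact mul_le_mul (hq l) (prod_pow_le_prod_max_pow l fun i => norm_nonneg _)
      (by positivity) ((abs_nonneg _).trans (hq l))
  · rw [Finset.sum_const, Finset.card_univ, Fintype.card_fun, Fintype.card_fin, Fintype.card_fin,
      nsmul_eq_mul]
    push_cast
    ring

variable {K : Type*} [Field K] [NumberField K]

lemma finitePlace_intCast_le_one (v : FinitePlace K) (n : ℤ) : v (n : K) ≤ 1 := by
  rw [← FinitePlace.norm_embedding_eq]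
  have := FinitePlace.norm_le_one (K := K) v.maximalIdeal (n : 𝓞 K)
  simpa using this

/-- By the ultrametric inequality, integral coefficients and the number of monomials cost nothing
here; they matter only at the archimedean places. -/
lemma finitePlace_boxEval_le (v : FinitePlace K) (q : (Fin t → Fin L) → ℤ) (x : Fin t → K) :
    v (boxEval q x) ≤ ∏ i, max (v (x i)) 1 ^ L := by
  have hC : 0 ≤ ∏ i, max (v (x i)) 1 ^ L :=
    Finset.prod_nonneg fun i _ => pow_nonneg (zero_le_one.trans (le_max_right _ _)) _
  refine Finset.sum_induction _ (fun y => v y ≤ ∏ i, max (v (x i)) 1 ^ L) ?_ ?_ ?_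
  · exact fun a b ha hb => (FinitePlace.add_le v a b).trans (max_le ha hb)
  · rwa [map_zero]
  · intro l _
    rw [map_mul, map_prod]
    simp only [map_pow]
    calc v (q l : K) * ∏ i, v (x i) ^ (l i : ℕ)
        ≤ 1 * ∏ i, max (v (x i)) 1 ^ L :=
          mul_le_mul (finitePlace_intCast_le_one v _)
            (prod_pow_le_prod_max_pow l fun i => apply_nonneg v _)
            (Finset.prod_nonneg fun i _ => pow_nonneg (apply_nonneg v _) _) zero_le_one
      _ = _ := one_mul _

lemma hasFiniteMulSupport_max_finitePlace (x : K) :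
    (fun v : FinitePlace K => max (v x) 1).HasFiniteMulSupport := by
  rcases eq_or_ne x 0 with rfl | hx
  · simp [Function.HasFiniteMulSupport, Function.mulSupport]
  · refine (FinitePlace.hasFiniteMulSupport hx).subset fun v hv h => hv ?_
    simp only at h
    simp [h]

/-- The product formula for a nonzero polynomial value, as a lower bound. -/
theorem one_le_prod_mul_prod_mulHeight₁ {q : (Fin t → Fin L) → ℤ} {x : Fin t → K}
    (hx : boxEval q x ≠ 0) {B : (K →+* ℂ) → ℝ}
    (hB : ∀ φ, ‖φ (boxEval q x)‖ ≤ B φ * ∏ i, max ‖φ (x i)‖ 1 ^ L) :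
    1 ≤ (∏ φ, B φ) * ∏ i, mulHeight₁ (x i) ^ L := by
  have hfs : ∀ i, (fun v : FinitePlace K => max (v (x i)) 1 ^ L).HasFiniteMulSupport := fun i =>
    (hasFiniteMulSupport_max_finitePlace (x i)).subset fun v hv h => hv (by
      simp only at h
      simp [h])
  have hfin : ∏ᶠ v : FinitePlace K, v (boxEval q x) ≤
      ∏ i, (∏ᶠ v : FinitePlace K, max (v (x i)) 1) ^ L := by
    calc ∏ᶠ v : FinitePlace K, v (boxEval q x)
        ≤ ∏ᶠ v : FinitePlace K, ∏ i, max (v (x i)) 1 ^ L := by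
          refine finprod_le_finprod (FinitePlace.hasFiniteMulSupport hx)
            (fun v => apply_nonneg v _) ?_ fun v => finitePlace_boxEval_le v q x
          refine (Set.finite_iUnion hfs).subset fun v hv => ?_
          by_contra hcon
          refine hv (Finset.prod_eq_one fun i _ => ?_)
          by_contra h1
          exact hcon (Set.mem_iUnion.mpr ⟨i, h1⟩)
      _ = ∏ i, ∏ᶠ v : FinitePlace K, max (v (x i)) 1 ^ L :=
          finprod_prod_comm _ _ fun i _ => hfs i
      _ = _ := Finset.prod_congr rfl fun i _ =>
          (finprod_pow (hasFiniteMulSupport_max_finitePlace (x i)) L).symm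
  have hprod : ∏ φ : K →+* ℂ, ∏ i, max ‖φ (x i)‖ 1 ^ L =
      ∏ i, (∏ φ : K →+* ℂ, max ‖φ (x i)‖ 1) ^ L := by
    rw [Finset.prod_comm]
    exact Finset.prod_congr rfl fun i _ => Finset.prod_pow _ _ _
  rw [← prod_embeddings_mul_finprod_eq_one hx]
  calc (∏ φ : K →+* ℂ, ‖φ (boxEval q x)‖) * ∏ᶠ v : FinitePlace K, v (boxEval q x)
      ≤ (∏ φ : K →+* ℂ, B φ * ∏ i, max ‖φ (x i)‖ 1 ^ L) *
        ∏ i, (∏ᶠ v : FinitePlace K, max (v (x i)) 1) ^ L :=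
        mul_le_mul (Finset.prod_le_prod (fun φ _ => norm_nonneg _) fun φ _ => hB φ) hfin
          (finprod_nonneg fun v => apply_nonneg v _)
          (Finset.prod_nonneg fun φ _ => (norm_nonneg _).trans (hB φ))
    _ = (∏ φ, B φ) * ∏ i, mulHeight₁ (x i) ^ L := by
        rw [Finset.prod_mul_distrib, hprod, mul_assoc, ← Finset.prod_mul_distrib]
        congr 1
        refine Finset.prod_congr rfl fun i _ => ?_
        rw [mulHeight₁_eq_prod_embeddings, mul_pow]

end BoxEval

/-! ### Liouville's inequality and Siegel's lemma at algebraic points. -/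

section AlgebraicPoints

variable {t L : ℕ}

lemma numberField_adjoin_range {α : Fin t → ℂ} (hα : ∀ i, IsAlgebraic ℚ (α i)) :
    NumberField (IntermediateField.adjoin ℚ (range α)) := by
  have : FiniteDimensional ℚ (IntermediateField.adjoin ℚ (range α)) :=
    IntermediateField.finiteDimensional_adjoin fun x hx => by
      obtain ⟨i, rfl⟩ := hx
      exact (hα i).isIntegral
  exact {}

/-- The coordinates of `α` as elements of the field that they generate. -/
def adjoinGen (α : Fin t → ℂ) (i : Fin t) : IntermediateField.adjoin ℚ (range α) :=
  ⟨α i, IntermediateField.subset_adjoin ℚ _ (mem_range_self i)⟩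

lemma coe_boxEval_adjoinGen (α : Fin t → ℂ) (q : (Fin t → Fin L) → ℤ) :
    ((boxEval q (adjoinGen α) : IntermediateField.adjoin ℚ (range α)) : ℂ) = boxEval q α :=
  map_boxEval (algebraMap (IntermediateField.adjoin ℚ (range α)) ℂ) q (adjoinGen α)

lemma boxEval_adjoinGen_eq_zero_iff (α : Fin t → ℂ) (q : (Fin t → Fin L) → ℤ) :
    boxEval q (adjoinGen α) = 0 ↔ boxEval q α = 0 := by
  rw [← coe_boxEval_adjoinGen, ZeroMemClass.coe_eq_zero]

/-- The bound `B` may vary with the embedding. Liouville's inequality singles out the identity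
embedding, while Siegel's lemma uses the same small bound at all of them. -/
lemma one_le_prod_mul_exp {α : Fin t → ℂ}
    [NumberField (IntermediateField.adjoin ℚ (range α))] {N : ℝ}
    (hN : ∀ i, absLogHeight₁ (α i) ≤ N)
    {q : (Fin t → Fin L) → ℤ} (hq : boxEval q α ≠ 0)
    {B : (IntermediateField.adjoin ℚ (range α) →+* ℂ) → ℝ}
    (hB : ∀ φ, ‖φ (boxEval q (adjoinGen α))‖ ≤ B φ * ∏ i, max ‖φ (adjoinGen α i)‖ 1 ^ L) :
    1 ≤ (∏ φ, B φ) *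
      Real.exp (t * L * N) ^ Module.finrank ℚ (IntermediateField.adjoin ℚ (range α)) := by
  have h0 : boxEval q (adjoinGen α) ≠ 0 := fun h => hq ((boxEval_adjoinGen_eq_zero_iff α q).mp h)
  have hB0 : 0 ≤ ∏ φ, B φ := Finset.prod_nonneg fun φ _ => by
    have hM : 0 < ∏ i, max ‖φ (adjoinGen α i)‖ 1 ^ L :=
      Finset.prod_pos fun i _ => pow_pos (zero_lt_one.trans_le (le_max_right _ _)) _
    exact nonneg_of_mul_nonneg_left ((norm_nonneg _).trans (hB φ)) hM
  refine (one_le_prod_mul_prod_mulHeight₁ h0 hB).trans (mul_le_mul_of_nonneg_left ?_ hB0)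
  calc ∏ i, mulHeight₁ (adjoinGen α i) ^ L
      ≤ ∏ _i : Fin t, Real.exp
          (Module.finrank ℚ (IntermediateField.adjoin ℚ (range α)) * N) ^ L := by
        refine Finset.prod_le_prod (fun i _ => pow_nonneg (mulHeight₁_nonneg _) _) fun i _ => ?_
        refine pow_le_pow_left₀ (mulHeight₁_nonneg _) ?_ _
        rw [mulHeight₁_eq_exp_absLogHeight₁, Real.exp_le_exp]
        exact mul_le_mul_of_nonneg_left (hN i) (Nat.cast_nonneg _)
    _ = _ := by
        rw [Finset.prod_const, Finset.card_univ, Fintype.card_fin, ← Real.exp_nat_mul,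
          ← Real.exp_nat_mul, ← Real.exp_nat_mul]
        congr 1
        ring

/-- Liouville's inequality for polynomial values at an algebraic point. -/
theorem one_le_norm_boxEval_mul {α : Fin t → ℂ} {D : ℕ} {N H : ℝ}
    (hα : ∀ i, IsAlgebraic ℚ (α i) ∧ absLogHeight₁ (α i) ≤ N)
    (hD : Module.finrank ℚ (IntermediateField.adjoin ℚ (range α)) ≤ D) (hN : 0 ≤ N)
    {q : (Fin t → Fin L) → ℤ} (hH : ∀ l, |(q l : ℝ)| ≤ H) (hHL : 1 ≤ H * (L : ℝ) ^ t)
    (hq : boxEval q α ≠ 0) :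
    1 ≤ ‖boxEval q α‖ * (H * (L : ℝ) ^ t) ^ (D - 1) * Real.exp (t * L * N) ^ D := by
  classical
  have := numberField_adjoin_range fun i => (hα i).1
  set K := IntermediateField.adjoin ℚ (range α) with hK
  let φ₀ : K →+* ℂ := algebraMap K ℂ
  have hB := one_le_prod_mul_exp (fun i => (hα i).2) hq
    (B := fun φ => if φ = φ₀ then ‖boxEval q α‖ else H * (L : ℝ) ^ t) (fun φ => by
      split_ifs with h
      · subst h
        have h1 : φ₀ (boxEval q (adjoinGen α)) = boxEval q α := coe_boxEval_adjoinGen α q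
        rw [h1]
        refine le_mul_of_one_le_right (norm_nonneg _) ?_
        exact Finset.one_le_prod fun i _ => one_le_pow₀ (le_max_right _ _)
      · rw [map_boxEval]
        exact norm_boxEval_le hH _)
  rw [Finset.prod_ite, Finset.filter_eq' Finset.univ φ₀, if_pos (Finset.mem_univ _),
    Finset.prod_singleton, Finset.prod_const, Finset.filter_ne', Finset.card_erase_of_mem
    (Finset.mem_univ _), Finset.card_univ, Embeddings.card K ℂ] at hB
  refine hB.trans ?_
  refine mul_le_mul (mul_le_mul_of_nonneg_left (pow_le_pow_right₀ hHL (by omega))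
    (norm_nonneg _)) (pow_le_pow_right₀ (Real.one_le_exp (by positivity)) hD)
    (by positivity) (by positivity)

/-- Siegel's lemma for polynomials vanishing at finitely many algebraic points of bounded degree
and height. -/
theorem exists_boxEval_eq_zero {ι : Type*} [Fintype ι] {α : ι → Fin t → ℂ} {D : ℕ} {N : ℝ}
    (hα : ∀ w i, IsAlgebraic ℚ (α w i) ∧ absLogHeight₁ (α w i) ≤ N)
    (hD : ∀ w, Module.finrank ℚ (IntermediateField.adjoin ℚ (range (α w))) ≤ D)
    (hL : 1 ≤ L) (hcard : 2 * (D * Fintype.card ι) ≤ L ^ t) {H : ℕ}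
    (hH : 4 * (L : ℝ) ^ t * Real.exp (t * L * N) < H) :
    ∃ q : (Fin t → Fin L) → ℤ, q ≠ 0 ∧ (∀ l, |q l| ≤ H) ∧ ∀ w, boxEval q (α w) = 0 := by
  classical
  have hL0 : (0 : ℝ) < L := by exact_mod_cast hL
  have hH0 : (0 : ℝ) < H := lt_of_le_of_lt (by positivity) hH
  have : NeZero L := ⟨by omega⟩
  have hnf : ∀ w, NumberField (IntermediateField.adjoin ℚ (range (α w))) := fun w =>
    numberField_adjoin_range fun i => (hα w i).1
  let J := Σ w, (IntermediateField.adjoin ℚ (range (α w)) →+* ℂ)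
  have hJ : Fintype.card J ≤ D * Fintype.card ι := by
    rw [Fintype.card_sigma]
    refine (Finset.sum_le_sum (g := fun _ => D) fun w _ => ?_).trans (le_of_eq ?_)
    · rw [Embeddings.card]; exact hD w
    · rw [Finset.sum_const, Finset.card_univ, smul_eq_mul, mul_comm]
  let m : J → (Fin t → Fin L) → ℂ := fun j l => ∏ i, j.2 (adjoinGen (α j.1) i) ^ (l i : ℕ)
  let M : J → ℝ := fun j => ∏ i, max ‖j.2 (adjoinGen (α j.1) i)‖ 1 ^ L
  have hM : ∀ j, 0 < M j := fun j =>
    Finset.prod_pos fun i _ => pow_pos (zero_lt_one.trans_le (le_max_right _ _)) _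
  have hm : ∀ j l, ‖m j l‖ ≤ M j := fun j l => by
    simp only [m, M, norm_prod, norm_pow]
    exact prod_pow_le_prod_max_pow l fun i => norm_nonneg _
  -- One real form per embedding, real part plus imaginary part, instead of two: this keeps the
  -- number of forms at most `D` per point. Normalised by `M j`, each of the `L ^ t` coefficients is
  -- at most `2`.
  obtain ⟨q, hq0, hqH, hq⟩ := exists_int_vec_linearForms_le
    (l := fun (j : J) l => ((m j l).re + (m j l).im) / M j) (A := 2 * (L : ℝ) ^ t) (by positivity)
    (fun j => by
      refine (Finset.sum_le_sum (g := fun _ => (2 : ℝ)) fun l _ => ?_).trans (le_of_eq ?_)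
      · rw [abs_div, abs_of_pos (hM j), div_le_iff₀ (hM j)]
        have h1 := abs_add_le (m j l).re (m j l).im
        have h2 := Complex.abs_re_le_norm (m j l)
        have h3 := Complex.abs_im_le_norm (m j l)
        linarith [hm j l]
      · rw [Finset.sum_const, Finset.card_univ, Fintype.card_fun, Fintype.card_fin,
          Fintype.card_fin, nsmul_eq_mul]
        push_cast
        ring)
    (by
      rw [Fintype.card_fun, Fintype.card_fin, Fintype.card_fin]
      omega)
    (H := H) (by exact_mod_cast hH0)
  refine ⟨q, hq0, hqH, fun w => ?_⟩
  by_contra hne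
  set ε : ℝ := 2 * (2 * (L : ℝ) ^ t) / H with hε
  set x := boxEval q (adjoinGen (α w)) with hx
  have hform : ∀ φ : IntermediateField.adjoin ℚ (range (α w)) →+* ℂ,
      |(φ x).re + (φ x).im| ≤ ε * M ⟨w, φ⟩ := by
    intro φ
    have h1 := hq ⟨w, φ⟩
    have h2 : (φ x).re + (φ x).im =
        (∑ l, ((m ⟨w, φ⟩ l).re + (m ⟨w, φ⟩ l).im) / M ⟨w, φ⟩ * q l) * M ⟨w, φ⟩ := by
      rw [hx, map_boxEval, boxEval, Complex.re_sum, Complex.im_sum, ← Finset.sum_add_distrib,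
        Finset.sum_mul]
      refine Finset.sum_congr rfl fun l _ => ?_
      have hMne := (hM ⟨w, φ⟩).ne'
      simp only [Complex.mul_re, Complex.mul_im, Complex.intCast_re, Complex.intCast_im, zero_mul,
        sub_zero, add_zero]
      field_simp
      rfl
    rw [h2, abs_mul, abs_of_pos (hM _)]
    exact mul_le_mul_of_nonneg_right h1 (hM _).le
  have hbound : ∀ φ : IntermediateField.adjoin ℚ (range (α w)) →+* ℂ,
      ‖φ x‖ ≤ ε * M ⟨w, φ⟩ := by
    intro φ
    have h1 := hform φ
    -- The conjugate embedding supplies real part minus imaginary part; the mean of the two squares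
    -- is `‖φ x‖ ^ 2`.
    have h2 := hform ((starRingEnd ℂ).comp φ)
    have hMc : M ⟨w, (starRingEnd ℂ).comp φ⟩ = M ⟨w, φ⟩ := by
      simp [M]
    rw [hMc, RingHom.comp_apply, Complex.conj_re, Complex.conj_im] at h2
    have hpos : 0 ≤ ε * M ⟨w, φ⟩ := (abs_nonneg _).trans h1
    refine le_of_sq_le_sq ?_ hpos
    rw [Complex.sq_norm, Complex.normSq_apply]
    have h3 := sq_le_sq' (abs_le.mp h1).1 (abs_le.mp h1).2
    have h4 := sq_le_sq' (abs_le.mp h2).1 (abs_le.mp h2).2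
    nlinarith
  have hfinal := one_le_prod_mul_exp (fun i => (hα w i).2) hne (B := fun _ => ε) hbound
  rw [Finset.prod_const, Finset.card_univ, Embeddings.card, ← mul_pow] at hfinal
  -- The choice of `H` makes `ε * exp (tLN) < 1`, which contradicts the product formula for a
  -- nonzero value.
  refine absurd hfinal (not_le.mpr (pow_lt_one₀ (by positivity) ?_ Module.finrank_pos.ne'))
  rw [hε, div_mul_eq_mul_div, div_lt_one hH0]
  linarith

end AlgebraicPoints

end AlgValues

namespace AlgValues

open NumberField

/-! ### Extrapolation from one set of points to the next. -/

section Extrapolation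

variable {t L : ℕ}

/-- A nonzero polynomial in algebraically independent functions is not identically zero. -/
lemma not_eqOn_boxEval_zero {f : Fin t → ℂ → ℂ} {U : Set ℂ}
    (hf : AlgebraicIndependent ℚ fun i => U.domRestrict (f i)) {q : (Fin t → Fin L) → ℤ}
    (hq : q ≠ 0) : ¬ EqOn (fun z => boxEval q fun i => f i z) 0 U := by
  classical
  intro h0
  let e : (Fin t → Fin L) → (Fin t →₀ ℕ) := fun l =>
    Finsupp.equivFunOnFinite.symm fun i => (l i : ℕ)
  have he : Function.Injective e := fun l l' h => by
    funext i
    exact Fin.ext (DFunLike.congr_fun h i)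
  let P : MvPolynomial (Fin t) ℚ := ∑ l, MvPolynomial.monomial (e l) (q l : ℚ)
  have hP : MvPolynomial.aeval (fun i => U.domRestrict (f i)) P = 0 := by
    funext z
    have hz := h0 z.2
    simp only [boxEval, Pi.zero_apply] at hz
    rw [map_sum, Finset.sum_apply, Pi.zero_apply, ← hz]
    refine Finset.sum_congr rfl fun l _ => ?_
    rw [MvPolynomial.aeval_monomial, Finsupp.prod_fintype _ _ (fun i => pow_zero _)]
    simp [e, Finset.prod_apply]
  have hP0 : P = 0 := algebraicIndependent_iff.mp hf P hP
  refine hq (funext fun l => ?_)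
  have hc : MvPolynomial.coeff (e l) P = (q l : ℚ) := by
    simp only [P, MvPolynomial.coeff_sum, MvPolynomial.coeff_monomial, he.eq_iff]
    simp
  rw [hP0, MvPolynomial.coeff_zero] at hc
  exact_mod_cast hc.symm

variable {r R : ℝ} {f : Fin t → ℂ → ℂ} {C : ℝ}

/-- A polynomial in the `f i` with enough zeros vanishes at the points of bounded degree and
height. -/
theorem boxEval_eq_zero_of_mem_sigmaSet (hr : 0 < r) (hrR : r < R)
    (hf_an : ∀ i, AnalyticOnNhd ℂ (f i) (ball (0 : ℂ) R))
    (hf_cont : ∀ i, ContinuousOn (f i) (closedBall (0 : ℂ) R)) (hC : 1 ≤ C)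
    (hfC : ∀ i, ∀ z ∈ closedBall (0 : ℂ) R, ‖f i z‖ ≤ C)
    {q : (Fin t → Fin L) → ℤ} {H : ℝ} (hH : ∀ l, |(q l : ℝ)| ≤ H) (hHL : 1 ≤ H * (L : ℝ) ^ t)
    {S : Finset ℂ} (hS : ∀ a ∈ S, ‖a‖ ≤ r) (hSq : ∀ a ∈ S, boxEval q (fun i => f i a) = 0)
    {D : ℕ} {N : ℝ} (hN : 0 ≤ N)
    (hlt : D * Real.log (H * (L : ℝ) ^ t) + D * (t * L * N) + t * L * Real.log C <
      c₀ r R * S.card) {w : ℂ} (hw : w ∈ sigmaSet f r D N) :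
    boxEval q (fun i => f i w) = 0 := by
  obtain ⟨hwr, hwα, hwD⟩ := hw
  by_contra hne
  have hwr' : ‖w‖ ≤ r := by simpa using hwr
  have := numberField_adjoin_range fun i => (hwα i).1
  have hDpos : 0 < D := Module.finrank_pos.trans_le hwD
  have hlow := one_le_norm_boxEval_mul hwα hwD hN hH hHL hne
  have hd : DifferentiableOn ℂ (fun z => boxEval q fun i => f i z) (ball 0 R) := by
    have : ∀ i, DifferentiableOn ℂ (f i) (ball 0 R) := fun i => (hf_an i).differentiableOn
    unfold boxEval
    fun_prop
  have hc : ContinuousOn (fun z => boxEval q fun i => f i z) (closedBall 0 R) := by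
    unfold boxEval
    fun_prop
  have hM : ∀ z ∈ closedBall (0 : ℂ) R,
      ‖boxEval q fun i => f i z‖ ≤ H * (L : ℝ) ^ t * C ^ (t * L) := by
    intro z hz
    refine (norm_boxEval_le hH _).trans (mul_le_mul_of_nonneg_left ?_ (by linarith))
    calc ∏ i, max ‖f i z‖ 1 ^ L ≤ ∏ _i : Fin t, C ^ L :=
          Finset.prod_le_prod (fun i _ => by positivity) fun i _ =>
            pow_le_pow_left₀ (by positivity) (max_le (hfC i z hz) hC) _
      _ = C ^ (t * L) := by
          rw [Finset.prod_const, Finset.card_univ, Fintype.card_fin, ← pow_mul, mul_comm]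
  have hup := norm_le_of_vanishing hr hrR S hd hc hM hS hSq hwr'
  set Q := H * (L : ℝ) ^ t
  have hQ : 0 < Q := zero_lt_one.trans_le hHL
  have hC0 : 0 < C := zero_lt_one.trans_le hC
  -- Multiplying Liouville's lower bound by the Schwarz upper bound; `hlt` says that the exponent is
  -- negative.
  have h1 : 1 ≤ Real.exp (D * Real.log Q + D * (t * L * N) + t * L * Real.log C -
      c₀ r R * S.card) := by
    refine hlow.trans ?_
    calc ‖boxEval q fun i => f i w‖ * Q ^ (D - 1) * Real.exp (t * L * N) ^ D
        ≤ (Q * C ^ (t * L) * Real.exp (-(c₀ r R * S.card))) * Q ^ (D - 1) *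
          Real.exp (t * L * N) ^ D := by gcongr
      _ = (Q * Q ^ (D - 1)) * Real.exp (t * L * N) ^ D * C ^ (t * L) *
          Real.exp (-(c₀ r R * S.card)) := by ring
      _ = Q ^ D * Real.exp (t * L * N) ^ D * C ^ (t * L) *
          Real.exp (-(c₀ r R * S.card)) := by
          rw [mul_pow_sub_one hDpos.ne']
      _ = _ := by
          rw [sub_eq_add_neg, Real.exp_add, Real.exp_add, Real.exp_add, Real.exp_nat_mul,
            Real.exp_log hQ, Real.exp_nat_mul]
          congr 2
          rw [← Nat.cast_mul, Real.exp_nat_mul, Real.exp_log hC0]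
  rw [Real.one_le_exp_iff] at h1
  linarith

/-- The sets `sigmaSet f r (D k) (N k)` cannot all be large. -/
theorem false_of_sigmaSet_large (hr : 0 < r) (hrR : r < R)
    (hf_an : ∀ i, AnalyticOnNhd ℂ (f i) (ball (0 : ℂ) R))
    (hf_cont : ∀ i, ContinuousOn (f i) (closedBall (0 : ℂ) R))
    (hf_ind : AlgebraicIndependent ℚ fun i => (ball (0 : ℂ) R).domRestrict (f i)) (hC : 1 ≤ C)
    (hfC : ∀ i, ∀ z ∈ closedBall (0 : ℂ) R, ‖f i z‖ ≤ C)
    {D : ℕ → ℕ} {N X : ℕ → ℝ} (hN : ∀ k, 0 ≤ N k) (hX0 : 0 ≤ X 0)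
    (hX : Filter.Tendsto X Filter.atTop Filter.atTop)
    (hS : ∀ k, ∃ S : Finset ℂ, (S : Set ℂ) ⊆ sigmaSet f r (D k) (N k) ∧ X k ≤ S.card)
    (hL : 1 ≤ L) (hLX : 2 * (D 0 * (X 0 + 1)) ≤ (L : ℝ) ^ t) (hD01 : D 0 ≤ D 1)
    (hN01 : N 0 ≤ N 1)
    (hE : ∀ k, D (k + 1) * (Real.log 5 + 2 * t * Real.log L + t * L * N 0) +
      D (k + 1) * (t * L * N (k + 1)) + t * L * Real.log C < c₀ r R * X k) : False := by
  have hL1 : (1 : ℝ) ≤ L := by exact_mod_cast hL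
  have hLt : (1 : ℝ) ≤ (L : ℝ) ^ t := one_le_pow₀ hL1
  obtain ⟨S', hS'sub, hS'card⟩ := hS 0
  -- Siegel's lemma needs an upper bound for the number of points, and the first set may be far
  -- larger or infinite. Only `⌈X 0⌉₊` points are kept.
  obtain ⟨S₀, hS₀S', hS₀card⟩ := Finset.exists_subset_card_eq (Nat.ceil_le.mpr hS'card)
  have hS₀ : ∀ a ∈ S₀, a ∈ sigmaSet f r (D 0) (N 0) := fun a ha => hS'sub (hS₀S' ha)
  set H : ℕ := ⌊4 * (L : ℝ) ^ t * Real.exp (t * L * N 0)⌋₊ + 1 with hHdef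
  have hexp : 1 ≤ Real.exp (t * L * N 0) := Real.one_le_exp (by have := hN 0; positivity)
  have hH : 4 * (L : ℝ) ^ t * Real.exp (t * L * N 0) < H := by
    rw [hHdef]; push_cast; exact Nat.lt_floor_add_one _
  have hH' : (H : ℝ) ≤ 5 * (L : ℝ) ^ t * Real.exp (t * L * N 0) := by
    have h1 : (⌊4 * (L : ℝ) ^ t * Real.exp (t * L * N 0)⌋₊ : ℝ) ≤
        4 * (L : ℝ) ^ t * Real.exp (t * L * N 0) := Nat.floor_le (by positivity)
    have h2 : 1 ≤ (L : ℝ) ^ t * Real.exp (t * L * N 0) :=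
      one_le_mul_of_one_le_of_one_le hLt hexp
    rw [hHdef]; push_cast; linarith
  have hH1 : (1 : ℝ) ≤ H := by exact_mod_cast Nat.le_add_left 1 _
  have hcard : 2 * (D 0 * Fintype.card S₀) ≤ L ^ t := by
    have h1 : (S₀.card : ℝ) ≤ X 0 + 1 := by
      rw [hS₀card]; exact (Nat.ceil_lt_add_one hX0).le
    have h2 : (2 * (D 0 * S₀.card) : ℝ) ≤ (L : ℝ) ^ t :=
      le_trans (by gcongr) hLX
    rw [Fintype.card_coe]
    exact_mod_cast h2
  obtain ⟨q, hq0, hqH, hq⟩ := exists_boxEval_eq_zero (α := fun (w : S₀) i => f i w)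
    (fun w => (hS₀ w w.2).2.1) (fun w => (hS₀ w w.2).2.2) hL hcard hH
  have hqH' : ∀ l, |(q l : ℝ)| ≤ (H : ℝ) := fun l => by exact_mod_cast hqH l
  have hHL : 1 ≤ (H : ℝ) * (L : ℝ) ^ t := one_le_mul_of_one_le_of_one_le hH1 hLt
  have hlog : Real.log ((H : ℝ) * (L : ℝ) ^ t) ≤
      Real.log 5 + 2 * t * Real.log L + t * L * N 0 := by
    have h1 : (H : ℝ) * (L : ℝ) ^ t ≤
        5 * (L : ℝ) ^ t * Real.exp (t * L * N 0) * (L : ℝ) ^ t := by gcongr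
    refine (Real.log_le_log (by linarith) h1).trans (le_of_eq ?_)
    have hLne : (L : ℝ) ^ t ≠ 0 := by positivity
    rw [Real.log_mul (by positivity) hLne, Real.log_mul (by positivity) (Real.exp_ne_zero _),
      Real.log_mul (by norm_num) hLne, Real.log_exp, Real.log_pow]
    ring
  have hnorm : ∀ {k a}, a ∈ sigmaSet f r (D k) (N k) → ‖a‖ ≤ r := fun ha => by
    simpa using ha.1
  have hc0 : 0 < c₀ r R := c₀_pos hr hrR
  have hzero : ∀ k, ∀ w ∈ sigmaSet f r (D k) (N k), boxEval q (fun i => f i w) = 0 := by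
    intro k
    induction k with
    | zero =>
      intro w hw
      refine boxEval_eq_zero_of_mem_sigmaSet hr hrR hf_an hf_cont hC hfC hqH' hHL (S := S₀)
        (fun a ha => hnorm (hS₀ a ha)) (fun a ha => hq ⟨a, ha⟩) (hN 0) ?_ hw
      -- `P` is known to vanish only on `S₀`, so the rest of the first set needs an extrapolation
      -- too. The inequality for the next set covers it, by `hD01` and `hN01`.
      refine lt_of_le_of_lt ?_ ((hE 0).trans_le
        (mul_le_mul_of_nonneg_left (hS₀card ▸ Nat.le_ceil _) hc0.le))
      have hD' : (D 0 : ℝ) ≤ D 1 := by exact_mod_cast hD01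
      have := hN 0
      have hlog0 : 0 ≤ Real.log ((H : ℝ) * (L : ℝ) ^ t) := Real.log_nonneg hHL
      rw [zero_add]
      gcongr
    | succ k ih =>
      intro w hw
      obtain ⟨S, hSsub, hScard⟩ := hS k
      refine boxEval_eq_zero_of_mem_sigmaSet hr hrR hf_an hf_cont hC hfC hqH' hHL (S := S)
        (fun a ha => hnorm (hSsub ha)) (fun a ha => ih a (hSsub ha)) (hN (k + 1)) ?_ hw
      refine lt_of_le_of_lt ?_ ((hE k).trans_le (mul_le_mul_of_nonneg_left hScard hc0.le))
      gcongr
  refine not_eqOn_boxEval_zero hf_ind hq0 (eqOn_zero_of_infinite_zeros hrR ?_ ?_)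
  · unfold boxEval
    intro z hz
    have : ∀ i, AnalyticAt ℂ (f i) z := fun i => hf_an i z hz
    fun_prop
  · intro hfin
    obtain ⟨k, hk⟩ := (hX.eventually_gt_atTop (hfin.toFinset.card : ℝ)).exists
    obtain ⟨S, hSsub, hScard⟩ := hS k
    have hle : S.card ≤ hfin.toFinset.card := Finset.card_le_card fun a ha => by
      rw [Set.Finite.mem_toFinset]
      exact ⟨(hSsub ha).1, hzero k a (hSsub ha)⟩
    have : (S.card : ℝ) ≤ hfin.toFinset.card := by exact_mod_cast hle
    linarith

lemma exists_finset_of_not_finite_and_lt {s : Set ℂ} {x : ℝ}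
    (h : ¬ (s.Finite ∧ (s.ncard : ℝ) < x)) : ∃ S : Finset ℂ, (S : Set ℂ) ⊆ s ∧ x ≤ S.card := by
  by_cases hs : s.Finite
  · refine ⟨hs.toFinset, by simp, ?_⟩
    rw [← Set.ncard_eq_toFinset_card s hs]
    exact not_lt.mp fun hlt => h ⟨hs, hlt⟩
  · obtain ⟨S, hSs, hcard⟩ := Set.Infinite.exists_subset_card_eq hs ⌈x⌉₊
    exact ⟨S, hSs, hcard ▸ Nat.le_ceil _⟩

end Extrapolation

end AlgValues

namespace AlgValues

/-! ### Choice of parameters and growth of the bound. -/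

section Numerics

/-- The upper bound for the number of points. -/
noncomputable def countBound (γ : ℝ) (t : ℕ) (D N : ℝ) : ℝ :=
  γ * D ^ (((t : ℝ) + 1) / ((t : ℝ) - 1)) * N ^ ((t : ℝ) / ((t : ℝ) - 1))

/-- The (approximate) degree in each variable of the auxiliary polynomial. -/
noncomputable def auxDegree (γ : ℝ) (t : ℕ) (D N : ℝ) : ℝ :=
  (2 * γ) ^ (1 / (t : ℝ)) * (D ^ 2 * N) ^ (1 / ((t : ℝ) - 1))

variable {t : ℕ} {γ r R D N : ℝ}

/-- Only the term `τ = t` of the maximum enters. -/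
lemma gammaConst_lt_imp (hr : 0 < r) (hrR : r < R) (ht : 2 ≤ t) (hγ : gammaConst r R t ht < γ) :
    0 < γ ∧ 2 * (3 * t / c₀ r R) ^ t ≤ γ ^ (t - 1) := by
  have hc := c₀_pos hr hrR
  have ht0 : (0 : ℝ) < t := by positivity
  have ht1 : (0 : ℝ) < (t : ℝ) - 1 := by
    have : (2 : ℝ) ≤ t := by exact_mod_cast ht
    linarith
  set b : ℝ := (1 / 2 : ℝ) * (c₀ r R / (3 * (t : ℝ))) ^ t with hb
  have hb0 : 0 < b := by positivity
  have hle : b ^ (-1 / ((t : ℝ) - 1)) < γ := lt_of_le_of_lt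
    (Finset.le_sup' (fun τ : ℕ =>
      ((1 / 2 : ℝ) * (c₀ r R / (3 * (τ : ℝ))) ^ τ) ^ (-1 / ((τ : ℝ) - 1)))
      (Finset.mem_Icc.mpr ⟨ht, le_rfl⟩)) hγ
  have hpos : 0 < b ^ (-1 / ((t : ℝ) - 1)) := Real.rpow_pos_of_pos hb0 _
  refine ⟨hpos.trans hle, ?_⟩
  have h1 : (b ^ (-1 / ((t : ℝ) - 1))) ^ (t - 1) = b⁻¹ := by
    rw [← Real.rpow_natCast, ← Real.rpow_mul hb0.le, Nat.cast_sub (by omega), Nat.cast_one,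
      div_mul_cancel₀ _ ht1.ne', Real.rpow_neg_one]
  have h2 : b⁻¹ = 2 * (3 * t / c₀ r R) ^ t := by
    rw [hb, mul_inv, ← inv_pow, inv_div]
    norm_num
  rw [← h2, ← h1]
  exact pow_le_pow_left₀ hpos.le hle.le _

lemma auxDegree_pos (hγ : 0 < γ) (hD : 0 < D) (hN : 0 < N) : 0 < auxDegree γ t D N := by
  unfold auxDegree
  positivity

lemma countBound_pos (hγ : 0 < γ) (hD : 0 < D) (hN : 0 < N) : 0 < countBound γ t D N := by
  unfold countBound
  positivity

/-- The equality case of the condition on unknowns and equations in Siegel's lemma, with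
`countBound` points of degree `D`. -/
lemma auxDegree_pow (ht : 2 ≤ t) (hγ : 0 < γ) (hD : 0 < D) (hN : 0 < N) :
    auxDegree γ t D N ^ t = 2 * D * countBound γ t D N := by
  have ht0 : (t : ℝ) ≠ 0 := by positivity
  have ht1 : (t : ℝ) - 1 ≠ 0 := by
    have : (2 : ℝ) ≤ t := by exact_mod_cast ht
    linarith
  have h1 : D * D ^ (((t : ℝ) + 1) / ((t : ℝ) - 1)) = (D ^ 2) ^ ((t : ℝ) / ((t : ℝ) - 1)) := by
    rw [← Real.rpow_one_add' hD.le, ← Real.rpow_natCast, ← Real.rpow_mul hD.le]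
    · congr 1
      field_simp
      push_cast
      ring
    · have : (2 : ℝ) ≤ t := by exact_mod_cast ht
      have : 0 < (t : ℝ) - 1 := by linarith
      positivity
  unfold auxDegree countBound
  rw [mul_pow, ← Real.rpow_natCast, ← Real.rpow_natCast, ← Real.rpow_mul (by positivity),
    ← Real.rpow_mul (by positivity), one_div_mul_cancel ht0, Real.rpow_one,
    one_div_mul_eq_div, Real.mul_rpow (by positivity) hN.le, ← h1]
  ring

/-- The inequality that dictates `γ_t`. The extrapolation uses a main term with `2` in place of `3`;
the excess absorbs rounding and lower-order terms. -/
lemma three_mul_auxDegree_le (hr : 0 < r) (hrR : r < R) (ht : 2 ≤ t)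
    (hγ : gammaConst r R t ht < γ) (hD : 0 < D) (hN : 0 < N) :
    3 * t * D * N * auxDegree γ t D N ≤ c₀ r R * countBound γ t D N := by
  obtain ⟨hγ0, hγt⟩ := gammaConst_lt_imp hr hrR ht hγ
  have hc := c₀_pos hr hrR
  have ht0 : (t : ℝ) ≠ 0 := by positivity
  have ht1 : (t : ℝ) - 1 ≠ 0 := by
    have : (2 : ℝ) ≤ t := by exact_mod_cast ht
    linarith
  set κ : ℝ := (2 * γ) ^ (1 / (t : ℝ)) with hκ
  have hκ0 : 0 < κ := by positivity
  have hκt : κ ^ t = 2 * γ := by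
    rw [hκ, ← Real.rpow_natCast, ← Real.rpow_mul (by positivity), one_div_mul_cancel ht0,
      Real.rpow_one]
  have hκ1 : 6 * t / c₀ r R ≤ κ ^ (t - 1) := by
    -- Taking `t`-th powers removes the root in `κ`, since `(κ ^ (t - 1)) ^ t = (2γ) ^ (t - 1)`.
    refine le_of_pow_le_pow_left₀ (n := t) (by omega) (by positivity) ?_
    calc (6 * t / c₀ r R) ^ t = 2 ^ t * (3 * t / c₀ r R) ^ t := by
          rw [← mul_pow]; congr 1; ring
      _ = 2 ^ (t - 1) * (2 * (3 * t / c₀ r R) ^ t) := by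
          rw [← mul_assoc, pow_sub_one_mul (by omega)]
      _ ≤ 2 ^ (t - 1) * γ ^ (t - 1) := by gcongr
      _ = (κ ^ (t - 1)) ^ t := by rw [← mul_pow, ← hκt, ← pow_mul, ← pow_mul, mul_comm]
  have hy := auxDegree_pos (t := t) hγ0 hD hN
  have hy1 : auxDegree γ t D N ^ (t - 1) = κ ^ (t - 1) * (D ^ 2 * N) := by
    have h1 : ((D ^ 2 * N) ^ (1 / ((t : ℝ) - 1))) ^ (t - 1) = D ^ 2 * N := by
      rw [← Real.rpow_natCast, ← Real.rpow_mul (by positivity), Nat.cast_sub (by omega),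
        Nat.cast_one, one_div_mul_cancel ht1, Real.rpow_one]
    rw [auxDegree, mul_pow, h1]
  have hyt := auxDegree_pow ht hγ0 hD hN
  rw [← pow_sub_one_mul (show t ≠ 0 by omega), hy1] at hyt
  have hX : countBound γ t D N = κ ^ (t - 1) * D * N * auxDegree γ t D N / 2 := by
    have : 2 * D ≠ 0 := by positivity
    refine mul_left_cancel₀ this ?_
    rw [← hyt]
    ring
  rw [hX]
  rw [div_le_iff₀ hc] at hκ1
  have h3 : 0 ≤ D * N * auxDegree γ t D N / 2 := by positivity
  calc 3 * t * D * N * auxDegree γ t D N = 6 * t * (D * N * auxDegree γ t D N / 2) := by ring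
    _ ≤ κ ^ (t - 1) * c₀ r R * (D * N * auxDegree γ t D N / 2) :=
        mul_le_mul_of_nonneg_right hκ1 h3
    _ = _ := by ring

/-- The choice of the degree of the auxiliary polynomial. -/
lemma exists_degree (ht : 2 ≤ t) (hγ : 0 < γ) (hD : 0 < D) (hN : 0 < N)
    (hX : 20 ≤ countBound γ t D N) (hy : 20 ≤ auxDegree γ t D N) :
    ∃ L : ℕ, 1 ≤ L ∧ 2 * (D * (countBound γ t D N + 1)) ≤ (L : ℝ) ^ t ∧
      (L : ℝ) ≤ 1.1 * auxDegree γ t D N := by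
  set y := auxDegree γ t D N with hydef
  -- The factor `1.05` absorbs the `+ 1` because `countBound ≥ 20`; rounding up costs at most `0.05
  -- * y` because `y ≥ 20`.
  refine ⟨⌈1.05 * y⌉₊, Nat.one_le_iff_ne_zero.mpr (Nat.ceil_pos.mpr (by linarith)).ne', ?_, ?_⟩
  · calc 2 * (D * (countBound γ t D N + 1)) ≤ 2 * (D * (1.05 * countBound γ t D N)) := by
          gcongr; linarith
      _ = 1.05 * y ^ t := by rw [hydef, auxDegree_pow ht hγ hD hN]; ring
      _ ≤ 1.05 ^ t * y ^ t := by
          gcongr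
          exact le_self_pow₀ (by norm_num) (by omega)
      _ = (1.05 * y) ^ t := by rw [mul_pow]
      _ ≤ _ := by
          gcongr
          exact Nat.le_ceil _
  · have := (Nat.ceil_lt_add_one (show (0 : ℝ) ≤ 1.05 * y by linarith)).le
    linarith

lemma one_le_exponents (ht : 2 ≤ t) :
    1 ≤ ((t : ℝ) + 1) / ((t : ℝ) - 1) ∧ 1 ≤ (t : ℝ) / ((t : ℝ) - 1) ∧ 0 < 1 / ((t : ℝ) - 1) := by
  have : (2 : ℝ) ≤ t := by exact_mod_cast ht
  have h : 0 < (t : ℝ) - 1 := by linarith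
  refine ⟨(one_le_div h).mpr (by linarith), (one_le_div h).mpr (by linarith), by positivity⟩

/-- The exponent of `N` is at least one. This is what lets the first extrapolation inequality
propagate to all later ones. -/
lemma mul_countBound_le_countBound_mul_right (ht : 2 ≤ t) (hγ : 0 < γ) (hD : 0 < D) (hN : 0 < N)
    {ρ : ℝ} (hρ : 1 ≤ ρ) : ρ * countBound γ t D N ≤ countBound γ t D (ρ * N) := by
  have h := Real.self_le_rpow_of_one_le hρ (one_le_exponents ht).2.1
  unfold countBound
  rw [Real.mul_rpow (by linarith) hN.le]
  have h3 : 0 ≤ γ * D ^ (((t : ℝ) + 1) / ((t : ℝ) - 1)) * N ^ ((t : ℝ) / ((t : ℝ) - 1)) := by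
    positivity
  nlinarith [mul_le_mul_of_nonneg_right h h3]

lemma mul_countBound_le_countBound_mul_left (ht : 2 ≤ t) (hγ : 0 < γ) (hD : 0 < D) (hN : 0 < N)
    {ρ : ℝ} (hρ : 1 ≤ ρ) : ρ * countBound γ t D N ≤ countBound γ t (ρ * D) N := by
  have h := Real.self_le_rpow_of_one_le hρ (one_le_exponents ht).1
  unfold countBound
  rw [Real.mul_rpow (by linarith) hD.le]
  have h3 : 0 ≤ γ * D ^ (((t : ℝ) + 1) / ((t : ℝ) - 1)) * N ^ ((t : ℝ) / ((t : ℝ) - 1)) := by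
    positivity
  nlinarith [mul_le_mul_of_nonneg_right h h3]

open Filter

lemma tendsto_countBound_right (ht : 2 ≤ t) (hγ : 0 < γ) (hD : 0 < D) :
    Tendsto (fun N => countBound γ t D N) atTop atTop :=
  (tendsto_rpow_atTop (zero_lt_one.trans_le (one_le_exponents ht).2.1)).const_mul_atTop
    (by positivity)

lemma tendsto_countBound_left (ht : 2 ≤ t) (hγ : 0 < γ) (hN : 0 < N) :
    Tendsto (fun D => countBound γ t D N) atTop atTop :=
  ((tendsto_rpow_atTop (zero_lt_one.trans_le (one_le_exponents ht).1)).const_mul_atTop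
    hγ).atTop_mul_const (by positivity)

lemma tendsto_auxDegree_right (ht : 2 ≤ t) (hγ : 0 < γ) (hD : 0 < D) :
    Tendsto (fun N => auxDegree γ t D N) atTop atTop :=
  ((tendsto_rpow_atTop (one_le_exponents ht).2.2).comp
    (tendsto_id.const_mul_atTop (by positivity))).const_mul_atTop (by positivity)

lemma tendsto_auxDegree_left (ht : 2 ≤ t) (hγ : 0 < γ) (hN : 0 < N) :
    Tendsto (fun D => auxDegree γ t D N) atTop atTop :=
  ((tendsto_rpow_atTop (one_le_exponents ht).2.2).comp
    ((tendsto_pow_atTop two_ne_zero).atTop_mul_const hN)).const_mul_atTop (by positivity)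

/-- The logarithmic terms are negligible with respect to the degree. -/
lemma eventually_log_le {a b ε : ℝ} (hε : 0 < ε) :
    ∀ᶠ y : ℝ in atTop, a + b * Real.log (1.1 * y) ≤ ε * y := by
  have h1 : Tendsto (fun y : ℝ => 1.1 * y) atTop atTop :=
    tendsto_id.const_mul_atTop (by norm_num)
  have h2 : (fun y : ℝ => a + b * Real.log y) =o[atTop] (id : ℝ → ℝ) :=
    (Asymptotics.isLittleO_const_id_atTop a).add (Real.isLittleO_log_id_atTop.const_mul_left b)
  have h3 := h1.eventually (h2.bound (show 0 < ε / 1.1 by positivity))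
  filter_upwards [h3, eventually_ge_atTop 0] with y hy hy0
  rw [id, Real.norm_eq_abs, Real.norm_eq_abs, abs_of_nonneg (by positivity : 0 ≤ 1.1 * y)] at hy
  refine (le_abs_self _).trans (hy.trans (le_of_eq ?_))
  field_simp

end Numerics

/-! ### The two cases: fixed degree and fixed height. -/

section Main

variable {t : ℕ} {γ r R : ℝ} {f : Fin t → ℂ → ℂ}

lemma exists_one_le_bound (hf_cont : ∀ i, ContinuousOn (f i) (closedBall (0 : ℂ) R)) :
    ∃ C : ℝ, 1 ≤ C ∧ ∀ i, ∀ z ∈ closedBall (0 : ℂ) R, ‖f i z‖ ≤ C := by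
  choose B hB using fun i =>
    (isCompact_closedBall (0 : ℂ) R).exists_bound_of_continuousOn (hf_cont i)
  refine ⟨1 + ∑ i, |B i|, le_add_of_nonneg_right (Finset.sum_nonneg fun i _ => abs_nonneg _),
    fun i z hz => ?_⟩
  have h1 := Finset.single_le_sum (f := fun i => |B i|) (fun i _ => abs_nonneg _)
    (Finset.mem_univ i)
  have h2 := (hB i z hz).trans (le_abs_self _)
  linarith

/-- For a fixed degree the bound holds for arbitrarily large heights. -/
theorem exists_height_ncard_lt (hr : 0 < r) (hrR : r < R) (ht : 2 ≤ t)
    (hγ : gammaConst r R t ht < γ)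
    (hf_an : ∀ i, AnalyticOnNhd ℂ (f i) (ball (0 : ℂ) R))
    (hf_cont : ∀ i, ContinuousOn (f i) (closedBall (0 : ℂ) R))
    (hf_ind : AlgebraicIndependent ℚ fun i => (ball (0 : ℂ) R).domRestrict (f i))
    {D : ℕ} (hD : 1 ≤ D) (A : ℝ) :
    ∃ N : ℝ, A ≤ N ∧ 0 ≤ N ∧ (sigmaSet f r D N).Finite ∧
      ((sigmaSet f r D N).ncard : ℝ) < countBound γ t D N := by
  by_contra! hcon
  obtain ⟨hγ0, -⟩ := gammaConst_lt_imp hr hrR ht hγ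
  obtain ⟨C, hC, hfC⟩ := exists_one_le_bound hf_cont
  have hlogC : 0 ≤ Real.log C := Real.log_nonneg hC
  have hD1 : (1 : ℝ) ≤ D := by exact_mod_cast hD
  have hD0 : (0 : ℝ) < D := by linarith
  have ht0 : (0 : ℝ) < t := by positivity
  have htX := tendsto_countBound_right ht hγ0 hD0
  have hty := tendsto_auxDegree_right ht hγ0 hD0
  obtain ⟨N₀, hNA, hN1, hNC, hX20, hy20, hlog⟩ :=
    ((Filter.eventually_ge_atTop A).and <| (Filter.eventually_ge_atTop 1).and <|
      (Filter.eventually_ge_atTop (2 * (1 + Real.log C))).and <|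
      (htX.eventually_ge_atTop 20).and <| (hty.eventually_ge_atTop 20).and <|
      hty.eventually (eventually_log_le (a := Real.log 5) (b := 2 * t)
        (show 0 < 0.1 * (t : ℝ) by positivity))).exists
  have hN0 : 0 < N₀ := by linarith
  obtain ⟨L, hL1, hLX, hLy⟩ := exists_degree ht hγ0 hD0 hN0 hX20 hy20
  have hmain := three_mul_auxDegree_le hr hrR ht hγ hD0 hN0
  set y := auxDegree γ t D N₀
  have hLpos : (0 : ℝ) < L := by exact_mod_cast hL1
  have hL1' : (1 : ℝ) ≤ L := by exact_mod_cast hL1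
  have hΛ : Real.log 5 + 2 * t * Real.log L ≤ 0.1 * t * y := by
    refine le_trans ?_ hlog
    gcongr
  have hΛ0 : 0 ≤ Real.log 5 + 2 * t * Real.log L := by
    have := Real.log_nonneg hL1'
    have : 0 ≤ Real.log 5 := Real.log_nonneg (by norm_num)
    positivity
  set Λ := Real.log 5 + 2 * t * Real.log L
  -- In units of `tyDN₀`, the logarithms give `0.1`, the two main terms `2.2`, and the shift to `N₀
  -- + 1` together with `log C` at most `0.55`: in total `2.85 < 3`.
  have hkey : D * (Λ + t * L * N₀) + D * (t * L * (N₀ + 1)) + t * L * Real.log C <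
      c₀ r R * countBound γ t D N₀ := by
    refine lt_of_lt_of_le ?_ hmain
    have hty0 : 0 < t * y := by positivity
    have h1 : (t : ℝ) * L ≤ 1.1 * (t * y) := by nlinarith
    have h2 : D * Λ ≤ 0.1 * (t * y) * (D * N₀) := by
      have : D * Λ ≤ D * (0.1 * t * y) := by gcongr
      have : D * (0.1 * t * y) * 1 ≤ D * (0.1 * t * y) * N₀ := by gcongr
      linarith
    have h3 : t * L * (2 * (D * N₀) + D + Real.log C) ≤
        1.1 * (t * y) * (2 * (D * N₀) + D + Real.log C) :=
      mul_le_mul_of_nonneg_right h1 (by positivity)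
    have h4 : 2 * (D + Real.log C) ≤ D * N₀ := by
      have h5 : D * (2 * (1 + Real.log C)) ≤ D * N₀ := by gcongr
      have h6 : Real.log C ≤ D * Real.log C := le_mul_of_one_le_left hlogC hD1
      linarith
    have h5 : 0 < D * N₀ := by positivity
    have h6 : t * y * (0.1 * (D * N₀) + 1.1 * (2 * (D * N₀) + D + Real.log C)) <
        t * y * (3 * (D * N₀)) := mul_lt_mul_of_pos_left (by linarith) hty0
    linarith
  refine false_of_sigmaSet_large hr hrR hf_an hf_cont hf_ind hC hfC (D := fun _ => D)
    (N := fun k => N₀ + k) (X := fun k => countBound γ t D (N₀ + k)) (L := L)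
    (fun k => by positivity) ?_ ?_ (fun k => ?_) hL1 ?_ le_rfl ?_ (fun k => ?_)
  · simpa using (countBound_pos hγ0 hD0 hN0).le
  · exact htX.comp (Filter.tendsto_atTop_add_const_left _ _ tendsto_natCast_atTop_atTop)
  · refine exists_finset_of_not_finite_and_lt fun h => ?_
    exact absurd h.2 (not_lt.mpr (hcon (N₀ + k) (by linarith [Nat.cast_nonneg (α := ℝ) k])
      (by positivity) h.1))
  · simpa using hLX
  · simp
  · have hk : (0 : ℝ) ≤ k := Nat.cast_nonneg k
    -- Scaling by `ρ` reduces the `k`-th inequality to `hkey`: the left side grows at most by the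
    -- factor `ρ`, the right side at least by `ρ`.
    set ρ : ℝ := (N₀ + k) / N₀ with hρ
    have hρN : ρ * N₀ = N₀ + k := div_mul_cancel₀ _ hN0.ne'
    have hρ1 : 1 ≤ ρ := by rw [hρ, one_le_div hN0]; linarith
    have hgrow := mul_countBound_le_countBound_mul_right ht hγ0 hD0 hN0 hρ1
    rw [hρN] at hgrow
    have hstep : D * (Λ + t * L * N₀) + D * (t * L * (N₀ + k + 1)) + t * L * Real.log C ≤
        ρ * (D * (Λ + t * L * N₀) + D * (t * L * (N₀ + 1)) + t * L * Real.log C) := by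
      have e1 : D * (Λ + t * L * N₀) ≤ ρ * (D * (Λ + t * L * N₀)) :=
        le_mul_of_one_le_left (by positivity) hρ1
      have e2 : t * L * Real.log C ≤ ρ * (t * L * Real.log C) :=
        le_mul_of_one_le_left (by positivity) hρ1
      have e3 : D * (t * L * (N₀ + k + 1)) ≤ D * (t * L * (ρ * (N₀ + 1))) := by
        gcongr
        linarith
      linarith
    have hc0 := c₀_pos hr hrR
    calc _ = D * (Λ + t * L * N₀) + D * (t * L * (N₀ + k + 1)) + t * L * Real.log C := by
          push_cast; simp only [Λ, add_zero, add_assoc]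
      _ ≤ _ := hstep
      _ < ρ * (c₀ r R * countBound γ t D N₀) := mul_lt_mul_of_pos_left hkey (by linarith)
      _ = c₀ r R * (ρ * countBound γ t D N₀) := by ring
      _ ≤ _ := mul_le_mul_of_nonneg_left hgrow hc0.le

/-- For a fixed height the bound holds for arbitrarily large degrees. -/
theorem exists_degree_ncard_lt (hr : 0 < r) (hrR : r < R) (ht : 2 ≤ t)
    (hγ : gammaConst r R t ht < γ)
    (hf_an : ∀ i, AnalyticOnNhd ℂ (f i) (ball (0 : ℂ) R))
    (hf_cont : ∀ i, ContinuousOn (f i) (closedBall (0 : ℂ) R))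
    (hf_ind : AlgebraicIndependent ℚ fun i => (ball (0 : ℂ) R).domRestrict (f i))
    {N : ℝ} (hN : 0 < N) (A : ℕ) :
    ∃ D : ℕ, A ≤ D ∧ 2 ≤ D ∧ (sigmaSet f r D N).Finite ∧
      ((sigmaSet f r D N).ncard : ℝ) < countBound γ t D N := by
  by_contra! hcon
  obtain ⟨hγ0, -⟩ := gammaConst_lt_imp hr hrR ht hγ
  obtain ⟨C, hC, hfC⟩ := exists_one_le_bound hf_cont
  have hlogC : 0 ≤ Real.log C := Real.log_nonneg hC
  have ht0 : (0 : ℝ) < t := by positivity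
  have hcast : Filter.Tendsto (fun D : ℕ => (D : ℝ)) Filter.atTop Filter.atTop :=
    tendsto_natCast_atTop_atTop
  have htX := (tendsto_countBound_left ht hγ0 hN).comp hcast
  have hty := (tendsto_auxDegree_left ht hγ0 hN).comp hcast
  obtain ⟨D₀, hDA, hD2, hDC, hX20, hy20, hlog⟩ :=
    ((Filter.eventually_ge_atTop A).and <| (Filter.eventually_ge_atTop 2).and <|
      ((hcast.atTop_mul_const hN).eventually_ge_atTop (4 * (N + Real.log C))).and <|
      (htX.eventually_ge_atTop 20).and <| (hty.eventually_ge_atTop 20).and <|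
      hty.eventually (eventually_log_le (a := Real.log 5) (b := 2 * t)
        (show 0 < 0.1 * (t : ℝ) * N by positivity))).exists
  simp only [Function.comp_apply] at hX20 hy20 hlog
  have hD0 : (0 : ℝ) < D₀ := by positivity
  obtain ⟨L, hL1, hLX, hLy⟩ := exists_degree ht hγ0 hD0 hN hX20 hy20
  have hmain := three_mul_auxDegree_le hr hrR ht hγ hD0 hN
  set y := auxDegree γ t D₀ N
  have hLpos : (0 : ℝ) < L := by exact_mod_cast hL1
  have hL1' : (1 : ℝ) ≤ L := by exact_mod_cast hL1
  have hΛ : Real.log 5 + 2 * t * Real.log L ≤ 0.1 * t * N * y := by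
    refine le_trans ?_ hlog
    gcongr
  have hΛ0 : 0 ≤ Real.log 5 + 2 * t * Real.log L := by
    have := Real.log_nonneg hL1'
    have : 0 ≤ Real.log 5 := Real.log_nonneg (by norm_num)
    positivity
  set Λ := Real.log 5 + 2 * t * Real.log L
  -- Here `D₀ + 1` multiplies the coefficient term as well. In units of `tyD₀N`, the main terms and
  -- logarithms give `2.3`, and the shift with `log C` at most `0.575`, still below `3`.
  have hkey : (D₀ + 1) * (Λ + t * L * N) + (D₀ + 1) * (t * L * N) + t * L * Real.log C <
      c₀ r R * countBound γ t D₀ N := by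
    refine lt_of_lt_of_le ?_ hmain
    have hty0 : 0 < t * y := by positivity
    have h1 : (t : ℝ) * L ≤ 1.1 * (t * y) := by nlinarith
    have h2 : (D₀ + 1) * Λ ≤ (D₀ + 1) * (0.1 * t * N * y) := by gcongr
    have h3 : t * L * (2 * ((D₀ + 1) * N) + Real.log C) ≤
        1.1 * (t * y) * (2 * ((D₀ + 1) * N) + Real.log C) :=
      mul_le_mul_of_nonneg_right h1 (by positivity)
    have h6 : t * y * (0.1 * ((D₀ + 1) * N) + 1.1 * (2 * ((D₀ + 1) * N) + Real.log C)) <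
        t * y * (3 * (D₀ * N)) := mul_lt_mul_of_pos_left (by linarith) hty0
    linarith
  refine false_of_sigmaSet_large hr hrR hf_an hf_cont hf_ind hC hfC (D := fun k => D₀ + k)
    (N := fun _ => N) (X := fun k => countBound γ t (D₀ + k) N) (L := L)
    (fun k => hN.le) ?_ ?_ (fun k => ?_) hL1 ?_ (by simp) le_rfl (fun k => ?_)
  · simpa using (countBound_pos hγ0 hD0 hN).le
  · exact (tendsto_countBound_left ht hγ0 hN).comp
      (Filter.tendsto_atTop_add_const_left _ _ tendsto_natCast_atTop_atTop)
  · refine exists_finset_of_not_finite_and_lt fun h => ?_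
    have := hcon (D₀ + k) (by omega) (by omega) h.1
    rw [Nat.cast_add] at this
    exact absurd h.2 (not_lt.mpr this)
  · simpa using hLX
  · have hk : (0 : ℝ) ≤ k := Nat.cast_nonneg k
    set ρ : ℝ := (D₀ + k) / D₀ with hρ
    have hρD : ρ * D₀ = D₀ + k := div_mul_cancel₀ _ hD0.ne'
    have hρ1 : 1 ≤ ρ := by rw [hρ, one_le_div hD0]; linarith
    have hgrow := mul_countBound_le_countBound_mul_left ht hγ0 hD0 hN hρ1
    rw [hρD] at hgrow
    have hstep : (D₀ + k + 1) * (Λ + t * L * N) + (D₀ + k + 1) * (t * L * N) +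
        t * L * Real.log C ≤ ρ * ((D₀ + 1) * (Λ + t * L * N) + (D₀ + 1) * (t * L * N) +
        t * L * Real.log C) := by
      have e0 : (D₀ + k + 1 : ℝ) ≤ ρ * (D₀ + 1) := by linarith
      have e1 : (D₀ + k + 1) * (Λ + t * L * N) ≤ ρ * (D₀ + 1) * (Λ + t * L * N) := by gcongr
      have e2 : t * L * Real.log C ≤ ρ * (t * L * Real.log C) :=
        le_mul_of_one_le_left (by positivity) hρ1
      have e3 : (D₀ + k + 1) * (t * L * N) ≤ ρ * (D₀ + 1) * (t * L * N) := by gcongr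
      linarith
    have hc0 := c₀_pos hr hrR
    calc _ = (D₀ + k + 1) * (Λ + t * L * N) + (D₀ + k + 1) * (t * L * N) +
        t * L * Real.log C := by push_cast; simp only [Λ, add_assoc]
      _ ≤ _ := hstep
      _ < ρ * (c₀ r R * countBound γ t D₀ N) := mul_lt_mul_of_pos_left hkey (by linarith)
      _ = c₀ r R * (ρ * countBound γ t D₀ N) := by ring
      _ ≤ _ := mul_le_mul_of_nonneg_left hgrow hc0.le

end Main

end AlgValues

theorem mainTheorem1 (r R : ℝ) (hr : 0 < r) (hrR : r < R) (t : ℕ) (ht : 2 ≤ t)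
    (γ : ℝ) (hγ : AlgValues.gammaConst r R t ht < γ)
    (f : Fin t → ℂ → ℂ)
    (hf_an : ∀ i, AnalyticOnNhd ℂ (f i) (ball (0 : ℂ) R))
    (hf_cont : ∀ i, ContinuousOn (f i) (closedBall (0 : ℂ) R))
    (hf_ind : AlgebraicIndependent ℚ (fun i => (ball (0 : ℂ) R).domRestrict (f i))) :
    (∀ D : ℕ, 1 ≤ D → ∀ A : ℝ, ∃ N : ℝ, A ≤ N ∧ 0 ≤ N ∧
      (AlgValues.sigmaSet f r D N).Finite ∧
      ((AlgValues.sigmaSet f r D N).ncard : ℝ) <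
        γ * (D : ℝ) ^ (((t : ℝ) + 1) / ((t : ℝ) - 1)) * N ^ ((t : ℝ) / ((t : ℝ) - 1))) ∧
    (∀ N : ℝ, 0 < N → ∀ A : ℕ, ∃ D : ℕ, A ≤ D ∧ 2 ≤ D ∧
      (AlgValues.sigmaSet f r D N).Finite ∧
      ((AlgValues.sigmaSet f r D N).ncard : ℝ) <
        γ * (D : ℝ) ^ (((t : ℝ) + 1) / ((t : ℝ) - 1)) * N ^ ((t : ℝ) / ((t : ℝ) - 1))) :=
  ⟨fun _ hD A =>
      AlgValues.exists_height_ncard_lt hr hrR ht hγ hf_an hf_cont hf_ind hD A,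
    fun _ hN A =>
      AlgValues.exists_degree_ncard_lt hr hrR ht hγ hf_an hf_cont hf_ind hN A⟩
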